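/- **Setting.** Let $0<m\le n$ be integers, let $\Omega\subseteq\mathbb R^n$ be open and bounded, and let $\mathcal A$ be the class of open subsets of $\Omega$. Let $X=(X_1,\dots,X_m)$ be a family of Lipschitz continuous vector fields on $\Omega$, $X_j=\sum_{i=1}^n c_{j,i}\,\partial_{x_i}$, where each $c_{j,i}$ is Lipschitz continuous on $\Omega$, and let $\mathcal C(x)=[c_{j,i}(x)]$ be the associated $m\times n$ matrix. For $A\in\mathcal A$ and $u\in L^1_{loc}(A)$, the $X$-gradient $Xu$ is the distribution $$Xu(\varphi)=-\int_A u\,\operatorname{div}(\varphi(x)\cdot\mathcal C(x))\,dx,\qquad \varphi\in C_c^\infty(A,\mathbb R^m).$$ For $p\in[1,+\infty)$ put $W^{1,p}_X(A)=\{u\in L^p(A): Xu\in L^p(A,\mathbb R^m)\}$, and let $W^{1,p}_{X,loc}(A)$ be the intersection of the spaces $W^{1,p}_X(B)$ over all open $B$ that are relatively compact in $A$. A function $f:\Omega\times\mathbb R\times\mathbb R^m\to[0,+\infty]$ is Carathéodory if $x\mapsto f(x,s,\eta)$ is measurable for all $(s,\eta)$ and $(s,\eta)\mapsto f(x,s,\eta)$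 is continuous for a.e. $x\in\Omega$. **Theorem.** Let $p\in[1,+\infty)$, let $f:\Omega\times\mathbb R\times\mathbb R^m\to[0,+\infty]$ be a Carathéodory function, and define $F:L^p(\Omega)\times\mathcal A\to[0,+\infty]$ by $$F(u,A)=\begin{cases}\displaystyle\int_A f(x,u(x),Xu(x))\,dx&\text{if } u\in W^{1,p}_{X,loc}(A),\\ +\infty&\text{otherwise.}\end{cases}$$ (i) Let $a\in L^1_{loc}(\Omega)$ and $b,c\ge 0$ be such that $$f(x,s,\mathcal C(x)\xi)\le a(x)+b|s|^p+c|\mathcal C(x)\xi|^p$$ for a.e. $x\in\Omega$, all $s\in\mathbb R$ and all $\xi\in\mathbb R^n$. Then $$F(u,A)\le\int_A a(x)+b|u(x)|^p+c|Xu(x)|^p\,dx$$ for all $A\in\mathcal A$ and all $u\in W^{1,p}_{X,loc}(A)\cap L^p(\Omega)$. (ii) Let $d>0$ be such that $d|\mathcal C(x)\xi|^p\le f(x,s,\mathcal C(x)\xi)$ for a.e. $x\in\Omega$, all $s\in\mathbb R$ and all $\xi\in\mathbb R^n$. Then $$d\int_A|Xu|^p\,dx\le F(u,A)$$ for all $A\in\mathcal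 A$ and all $u\in W^{1,p}_{X,loc}(A)\cap L^p(\Omega)$. (iii) Let $\tilde f:\Omega\times\mathbb R\times\mathbb R^m\to[0,+\infty]$ be a Carathéodory function such that $f(x,s,\mathcal C(x)\xi)=\tilde f(x,s,\mathcal C(x)\xi)$ for a.e. $x\in\Omega$, all $s\in\mathbb R$ and all $\xi\in\mathbb R^n$. Then $$F(u,A)=\int_A\tilde f(x,u(x),Xu(x))\,dx$$ for all $A\in\mathcal A$ and all $u\in W^{1,p}_{X,loc}(A)\cap L^p(\Omega)$. In these statements all integrals take values in $[0,+\infty]$. -/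

import Mathlib

open MeasureTheory Set Topology
open scoped ENNReal ContDiff Matrix

namespace Anisotropic

/-- `ℝⁿ` with its Euclidean norm. -/
abbrev E (n : ℕ) : Type := EuclideanSpace ℝ (Fin n)

/-- The coefficient matrix of `X = (X₁, …, X_m)`: row `j` of `C x` holds the coefficients
`c_{j,1} x, …, c_{j,n} x` of the vector field `X_j = ∑ i, c_{j,i} ∂/∂x_i`. -/
abbrev CoeffMatrix (m n : ℕ) : Type := E n → Matrix (Fin m) (Fin n) ℝ

/-- `X` is a family of Lipschitz continuous vector fields on `Ω`: every coefficient is Lipschitz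
continuous on `Ω`. -/
def IsLipschitzFamily {m n : ℕ} (C : CoeffMatrix m n) (Ω : Set (E n)) : Prop :=
  ∀ j i, ∃ K : NNReal, LipschitzOnWith K (fun x => C x j i) Ω

/-- The linear map `ξ ↦ C(x) · ξ` from `ℝⁿ` to `ℝᵐ`. -/
noncomputable def CoeffMatrix.act {m n : ℕ} (C : CoeffMatrix m n) (x : E n) (ξ : E n) : E m :=
  WithLp.toLp 2 (C x *ᵥ ξ.ofLp)

/-- The field `x ↦ φ(x) · C(x)` on `ℝⁿ`, where `φ(x) ∈ ℝᵐ` is read as a row vector. -/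
noncomputable def CoeffMatrix.pullField {m n : ℕ} (C : CoeffMatrix m n) (φ : E n → E m) :
    E n → E n :=
  fun x => WithLp.toLp 2 ((φ x).ofLp ᵥ* C x)

/-- The pointwise divergence `∑ i, ∂_i V_i`. It is applied to Lipschitz continuous fields, which
are differentiable almost everywhere. -/
noncomputable def divergence {n : ℕ} (V : E n → E n) (x : E n) : ℝ :=
  ∑ i, fderiv ℝ V x (EuclideanSpace.single i 1) i

/-- Smooth test fields `φ ∈ C_c^∞(A, ℝᵐ)`, extended by zero to `ℝⁿ`. -/
def IsTestField {m n : ℕ} (A : Set (E n)) (φ : E n → E m) : Prop :=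
  ContDiff ℝ ∞ φ ∧ HasCompactSupport φ ∧ tsupport φ ⊆ A

/-- The `X`-gradient of `u` on `A` as a distribution: `Xu(φ) = - ∫_A u div(φ · C) dx`. -/
noncomputable def xGradDistribution {m n : ℕ} (C : CoeffMatrix m n) (A : Set (E n))
    (u : E n → ℝ) (φ : E n → E m) : ℝ :=
  - ∫ x in A, u x * divergence (C.pullField φ) x

/-- The distribution `Xu` on `A` is the locally integrable function `g`. -/
def IsXGradient {m n : ℕ} (C : CoeffMatrix m n) (A : Set (E n)) (u : E n → ℝ)
    (g : E n → E m) : Prop :=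
  LocallyIntegrableOn g A ∧
    ∀ φ : E n → E m, IsTestField A φ →
      xGradDistribution C A u φ = ∫ x in A, inner ℝ (g x) (φ x)

/-- `u ∈ W^{1,p}_X(A)`: `u ∈ L^p(A)` and `Xu ∈ L^p(A, ℝᵐ)`. -/
def MemW {m n : ℕ} (C : CoeffMatrix m n) (A : Set (E n)) (p : ℝ) (u : E n → ℝ) : Prop :=
  MemLp u (ENNReal.ofReal p) (volume.restrict A) ∧
    ∃ g : E n → E m, IsXGradient C A u g ∧ MemLp g (ENNReal.ofReal p) (volume.restrict A)

/-- `u ∈ W^{1,p}_{X,loc}(A)`: `u ∈ W^{1,p}_X(B)` for every open `B` that is relatively compact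
in `A`. -/
def MemWLoc {m n : ℕ} (C : CoeffMatrix m n) (A : Set (E n)) (p : ℝ) (u : E n → ℝ) : Prop :=
  ∀ B : Set (E n), IsOpen B → IsCompact (closure B) → closure B ⊆ A → MemW C B p u

/-- The `X`-gradient `Xu` of `u` on `A` as a function. It is unique almost everywhere on the open
set `A` (`IsXGradient.ae_eq`), and it exists whenever `u ∈ W^{1,p}_{X,loc}(A)`
(`MemWLoc.isXGradient_xGrad`); only such `u` are considered. -/
noncomputable def xGrad {m n : ℕ} (C : CoeffMatrix m n) (A : Set (E n)) (u : E n → ℝ) :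
    E n → E m :=
  open Classical in if h : ∃ g : E n → E m, IsXGradient C A u g then h.choose else 0

/-- `f : Ω × ℝ × ℝᵐ → [0, ∞]` is a Carathéodory function: Lebesgue measurable in `x` for all
`(s, η)` and continuous in `(s, η)` for almost every `x`. -/
def IsCaratheodory {m n : ℕ} (Ω : Set (E n)) (f : E n → ℝ → E m → ℝ≥0∞) : Prop :=
  (∀ s η, AEMeasurable (fun x => f x s η) (volume.restrict Ω)) ∧
    ∀ᵐ x ∂(volume.restrict Ω), Continuous (fun q : ℝ × E m => f x q.1 q.2)

/-- The functional `F : L^p(Ω) × 𝒜 → [0, ∞]`, `F(u, A) = ∫_A f(x, u, Xu) dx` if `A` is an open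
subset of `Ω` and `u ∈ W^{1,p}_{X,loc}(A)`, and `F(u, A) = ∞` otherwise. -/
noncomputable def functional {m n : ℕ} (C : CoeffMatrix m n) (Ω : Set (E n)) (p : ℝ)
    (f : E n → ℝ → E m → ℝ≥0∞) (u : Lp ℝ (ENNReal.ofReal p) (volume.restrict Ω))
    (A : Set (E n)) : ℝ≥0∞ :=
  open Classical in
  if IsOpen A ∧ A ⊆ Ω ∧ MemWLoc C A p u then ∫⁻ x in A, f x (u x) (xGrad C A u x) else ∞

/-! Well-posedness of `xGrad`. -/

theorem integral_inner_eq_of_tsupport {m n : ℕ} {A B : Set (E n)} (hBA : B ⊆ A)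
    {φ : E n → E m} (hφ : tsupport φ ⊆ B) (g : E n → E m) :
    ∫ x in A, inner ℝ (g x) (φ x) = ∫ x in B, inner ℝ (g x) (φ x) := by
  have key : ∀ x, x ∉ B → inner ℝ (g x) (φ x) = 0 := fun x hx => by
    rw [image_eq_zero_of_notMem_tsupport (fun h => hx (hφ h)), inner_zero_right]
  rw [setIntegral_eq_integral_of_forall_compl_eq_zero key,
    setIntegral_eq_integral_of_forall_compl_eq_zero (fun x hx => key x (fun h => hx (hBA h)))]

theorem divergence_pullField_eq_zero {m n : ℕ} (C : CoeffMatrix m n) {φ : E n → E m} {x : E n}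
    (hx : x ∉ tsupport φ) : divergence (C.pullField φ) x = 0 := by
  have h1 : φ =ᶠ[𝓝 x] 0 := notMem_tsupport_iff_eventuallyEq.1 hx
  have h2 : C.pullField φ =ᶠ[𝓝 x] fun _ => 0 := by
    filter_upwards [h1] with y hy
    simp [CoeffMatrix.pullField, hy]
  simp [divergence, h2.fderiv_eq]

theorem xGradDistribution_eq_of_tsupport {m n : ℕ} (C : CoeffMatrix m n) {A B : Set (E n)}
    (hBA : B ⊆ A) {φ : E n → E m} (hφ : tsupport φ ⊆ B) (u : E n → ℝ) :
    xGradDistribution C A u φ = xGradDistribution C B u φ := by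
  have key : ∀ x, x ∉ B → u x * divergence (C.pullField φ) x = 0 := fun x hx => by
    rw [divergence_pullField_eq_zero C (fun h => hx (hφ h)), mul_zero]
  unfold xGradDistribution
  rw [setIntegral_eq_integral_of_forall_compl_eq_zero key,
    setIntegral_eq_integral_of_forall_compl_eq_zero (fun x hx => key x (fun h => hx (hBA h)))]

theorem IsXGradient.mono {m n : ℕ} {C : CoeffMatrix m n} {A B : Set (E n)} {u : E n → ℝ}
    {g : E n → E m} (hg : IsXGradient C A u g) (hBA : B ⊆ A) : IsXGradient C B u g := by
  refine ⟨hg.1.mono_set hBA, fun φ hφ => ?_⟩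
  rw [← xGradDistribution_eq_of_tsupport C hBA hφ.2.2,
    ← integral_inner_eq_of_tsupport hBA hφ.2.2]
  exact hg.2 φ ⟨hφ.1, hφ.2.1, hφ.2.2.trans hBA⟩

theorem integrableOn_inner_test {m n : ℕ} {A : Set (E n)} {g φ : E n → E m}
    (hg : LocallyIntegrableOn g A) (hφ : IsTestField A φ) :
    IntegrableOn (fun x => inner ℝ (g x) (φ x)) A := by
  have hK : IntegrableOn g (tsupport φ) :=
    hg.integrableOn_compact_subset hφ.2.2 hφ.2.1
  obtain ⟨M, hM⟩ := hφ.2.1.exists_bound_of_continuous hφ.1.continuous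
  have h1 : IntegrableOn (fun x => inner ℝ (g x) (φ x)) (tsupport φ) := by
    refine Integrable.mono' (hK.norm.mul_const M)
      (hK.aestronglyMeasurable.inner hφ.1.continuous.aestronglyMeasurable) ?_
    filter_upwards with x
    exact (norm_inner_le_norm _ _).trans (by gcongr; exact hM x)
  have h2 : Integrable (fun x => inner ℝ (g x) (φ x)) :=
    (integrableOn_iff_integrable_of_support_subset (fun x hx => by
      by_contra h
      exact hx (by simp [image_eq_zero_of_notMem_tsupport h]))).1 h1
  exact h2.integrableOn

theorem IsXGradient.ae_eq {m n : ℕ} {C : CoeffMatrix m n} {A : Set (E n)} (hA : IsOpen A)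
    {u : E n → ℝ} {g g' : E n → E m} (hg : IsXGradient C A u g) (hg' : IsXGradient C A u g') :
    ∀ᵐ x, x ∈ A → g x = g' x := by
  have hj : ∀ j : Fin m, ∀ᵐ x, x ∈ A → g x j - g' x j = 0 := by
    intro j
    have hloc : LocallyIntegrableOn (fun x => g x j - g' x j) A := fun x hx =>
      (((EuclideanSpace.proj j : E m →L[ℝ] ℝ).integrableAtFilter_comp (hg.1 x hx)).sub
        ((EuclideanSpace.proj j : E m →L[ℝ] ℝ).integrableAtFilter_comp (hg'.1 x hx)))
    refine hA.ae_eq_zero_of_integral_contDiff_smul_eq_zero hloc fun ψ hψ hψc hψA => ?_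
    have hsub : tsupport (fun x => ψ x • (EuclideanSpace.single j (1 : ℝ) : E m)) ⊆ tsupport ψ :=
      closure_mono fun x hx h => hx (by simp [h])
    have hφ : IsTestField A (fun x => ψ x • (EuclideanSpace.single j (1 : ℝ) : E m)) :=
      ⟨hψ.smul contDiff_const, hψc.smul_right, hsub.trans hψA⟩
    have e := (hg.2 _ hφ).symm.trans (hg'.2 _ hφ)
    rw [← sub_eq_zero, ← integral_sub (integrableOn_inner_test hg.1 hφ)
      (integrableOn_inner_test hg'.1 hφ)] at e
    rw [← setIntegral_eq_integral_of_forall_compl_eq_zero (s := A)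
      (fun x hx => by simp [image_eq_zero_of_notMem_tsupport (fun h => hx (hψA h))]), ← e]
    congr 1
    ext x
    simp [inner_smul_right, EuclideanSpace.inner_single_right]
    ring
  filter_upwards [ae_all_iff.2 hj] with x hx hxA
  ext j
  exact sub_eq_zero.1 (hx j hxA)

theorem MemWLoc.exists_isXGradient {m n : ℕ} {C : CoeffMatrix m n} {A : Set (E n)}
    (hA : IsOpen A) {p : ℝ} {u : E n → ℝ} (hu : MemWLoc C A p u) :
    ∃ g : E n → E m, IsXGradient C A u g := by
  have : LocallyCompactSpace A := hA.locallyCompactSpace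
  let K : CompactExhaustion A := default
  let U : ℕ → Set (E n) := fun k => Subtype.val '' interior (K k)
  have hUo : ∀ k, IsOpen (U k) := fun k => hA.isOpenMap_subtype_val _ isOpen_interior
  have hcl : ∀ k, closure (U k) ⊆ Subtype.val '' (K k) := fun k =>
    closure_minimal (image_mono interior_subset)
      ((K.isCompact k).image continuous_subtype_val).isClosed
  have hclA : ∀ k, closure (U k) ⊆ A := fun k =>
    (hcl k).trans (by rintro _ ⟨y, -, rfl⟩; exact y.2)
  have hUA : ∀ k, U k ⊆ A := fun k => subset_closure.trans (hclA k)
  have hUmono : ∀ {i j}, i ≤ j → U i ⊆ U j := fun hij =>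
    image_mono (interior_mono (K.subset hij))
  have hcov : ∀ x ∈ A, ∃ k, x ∈ U k := fun x hx => by
    obtain ⟨k, hk⟩ := K.exists_mem ⟨x, hx⟩
    exact ⟨k + 1, ⟨x, hx⟩, K.subset_interior_succ k hk, rfl⟩
  have hex : ∀ k, ∃ g : E n → E m, IsXGradient C (U k) u g := fun k => by
    obtain ⟨-, g, hg, -⟩ := hu (U k) (hUo k)
      (((K.isCompact k).image continuous_subtype_val).of_isClosed_subset isClosed_closure (hcl k))
      (hclA k)
    exact ⟨g, hg⟩
  choose G hG using hex
  classical
  let g : E n → E m := fun x => if h : ∃ k, x ∈ U k then G (Nat.find h) x else 0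
  have hgG : ∀ j, ∀ᵐ x, x ∈ U j → g x = G j x := by
    intro j
    have h1 : ∀ᵐ x, ∀ k, k ≤ j → x ∈ U k → G k x = G j x := by
      refine ae_all_iff.2 fun k => ?_
      by_cases hk : k ≤ j
      · filter_upwards [(hG k).ae_eq (hUo k) ((hG j).mono (hUmono hk))] with x hx _ using hx
      · exact Filter.Eventually.of_forall fun x h => absurd h hk
    filter_upwards [h1] with x hx hxj
    have h : ∃ k, x ∈ U k := ⟨j, hxj⟩
    simp only [g, dif_pos h]
    exact hx _ (Nat.find_min' h hxj) (Nat.find_spec h)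
  refine ⟨g, fun x hx => ?_, fun φ hφ => ?_⟩
  · obtain ⟨k, hk⟩ := hcov x hx
    obtain ⟨s, hs, hint⟩ := (hG k).1 x hk
    rw [(hUo k).nhdsWithin_eq hk] at hs
    refine ⟨s ∩ U k, mem_nhdsWithin_of_mem_nhds
      (Filter.inter_mem hs ((hUo k).mem_nhds hk)), ?_⟩
    refine Integrable.congr (hint.mono_set inter_subset_left) ?_
    have h2 : ∀ᵐ x ∂(volume.restrict (U k)), G k x = g x := by
      rw [ae_restrict_iff' (hUo k).measurableSet]
      filter_upwards [hgG k] with x hx hxk using (hx hxk).symm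
    exact ae_mono (Measure.restrict_mono inter_subset_right le_rfl) h2
  · obtain ⟨k, hk⟩ : ∃ k, tsupport φ ⊆ U k := by
      refine IsCompact.elim_directed_cover (s := tsupport φ) hφ.2.1 U hUo
        (fun x hx => mem_iUnion.2 (hcov x (hφ.2.2 hx))) ?_
      exact directed_of_isDirected_le fun i j hij => hUmono hij
    rw [xGradDistribution_eq_of_tsupport C (hUA k) hk, integral_inner_eq_of_tsupport (hUA k) hk,
      (hG k).2 φ ⟨hφ.1, hφ.2.1, hk⟩]
    refine setIntegral_congr_ae (hUo k).measurableSet ?_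
    filter_upwards [hgG k] with x hx hxk
    rw [hx hxk]

theorem MemWLoc.isXGradient_xGrad {m n : ℕ} {C : CoeffMatrix m n} {A : Set (E n)}
    (hA : IsOpen A) {p : ℝ} {u : E n → ℝ} (hu : MemWLoc C A p u) :
    IsXGradient C A u (xGrad C A u) := by
  have h := hu.exists_isXGradient hA
  rw [xGrad, dif_pos h]
  exact h.choose_spec

end Anisotropic

open Anisotropic

/-!
All three assertions are pointwise statements about `f x s η` that are only assumed for `η` in the
range of the matrix `C x`. They transfer to the functional because the `X`-gradient of `u` lies in
the range of `C x` for almost every `x` (`IsXGradient.ae_exists_act`).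

For smooth `u` this is clear from `Xu = C ∇u`. In general let `g` be the `X`-gradient on `A`, and
let `ψ` be a smooth function with compact support in `A` and `e` a vector. If `P x` denotes the
orthogonal projection onto the complement of the range of `C x`, which is the kernel of `C xᵀ`,
then `∫ ψ ⟪g, P e⟫ = 0` has to be shown. The field `ψ P e` is annihilated by `Cᵀ`, but it need not
even be continuous, as the rank of `C` may jump. It is therefore approximated by
`φ_k = ψ (1 + k² C Cᵀ)⁻¹ e`. The map `A ↦ Aᵀ (1 + A Aᵀ)⁻¹` is bounded by `1` and Lipschitz
continuous on all matrices (`norm_adjoint_resolventAt_apply_le`,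
`norm_adjoint_resolventAt_sub_le`), so by scaling the fields
`φ_k · C = k⁻¹ ψ (k C)ᵀ (1 + (k C) (k C)ᵀ)⁻¹ e` tend uniformly to zero with Lipschitz constants
independent of `k`. Hence their divergences tend to zero weakly-* in `L^∞`
(`tendsto_integral_mul_divergence_zero`), and `∫ u div (φ_k · C) → 0`, whereas
`∫ ⟪g, φ_k⟫ → ∫ ψ ⟪g, P e⟫` because the resolvents converge pointwise to `P`
(`tendsto_resolventAt_smul`).

The `φ_k` are only Lipschitz continuous. That they are admissible test fields follows by
mollification, again from the weak-* convergence of divergences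
(`integral_mul_divergence_adjoint_of_lipschitz`).
-/

namespace Anisotropic

open Filter Metric
open scoped NNReal Convolution

/-! ### Equi-Lipschitz sequences and mollification -/

section Lipschitz

theorem integrable_mul_lineDeriv {V : Type*} [NormedAddCommGroup V] [NormedSpace ℝ V]
    [MeasurableSpace V] [BorelSpace V] [SecondCountableTopology V] {μ : Measure V} {U h : V → ℝ}
    (hU : Integrable U μ) {K : ℝ≥0} (hh : LipschitzWith K h) (v : V) :
    Integrable (fun x => U x * lineDeriv ℝ h x v) μ :=
  hU.mul_bdd (c := K * ‖v‖) (aestronglyMeasurable_lineDeriv hh.continuous μ)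
    (.of_forall fun _ => norm_lineDeriv_le_of_lipschitz ℝ hh)

variable {V : Type*} [NormedAddCommGroup V] [NormedSpace ℝ V] [FiniteDimensional ℝ V]
  [MeasurableSpace V] [BorelSpace V] {μ : Measure V} [μ.IsAddHaarMeasure]

/-- The directional derivatives of an equi-Lipschitz sequence that converges uniformly to zero
tend to zero weakly-* in `L^∞`: tested against smooth functions this is integration by parts, and
smooth functions are dense in `L¹`. -/
theorem tendsto_integral_mul_lineDeriv_zero {U : V → ℝ} (hU : Integrable U μ) {h : ℕ → V → ℝ}
    {K : ℝ≥0} (hK : ∀ k, LipschitzWith K (h k)) {ε : ℕ → ℝ} (hε : Tendsto ε atTop (𝓝 0))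
    (hb : ∀ k x, |h k x| ≤ ε k) (v : V) :
    Tendsto (fun k => ∫ x, U x * lineDeriv ℝ (h k) x v ∂μ) atTop (𝓝 0) := by
  rw [Metric.tendsto_atTop]
  intro δ hδ
  have hM : (0 : ℝ) < K * ‖v‖ + 1 := by positivity
  obtain ⟨g, hgc, hgs, hg⟩ := (memLp_one_iff_integrable.2 hU).exist_eLpNorm_sub_le
    ENNReal.one_ne_top le_rfl (ε := δ / (2 * (K * ‖v‖ + 1))) (by positivity)
  obtain ⟨D, hD⟩ := hgs.lipschitzWith_of_hasCompactSupport hgc (by simp)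
  have hgi : Integrable g μ := hgs.continuous.integrable_of_hasCompactSupport hgc
  have hsub : ∫ x, ‖U x - g x‖ ∂μ ≤ δ / (2 * (K * ‖v‖ + 1)) := by
    rw [eLpNorm_one_eq_lintegral_enorm] at hg
    have e := integral_norm_eq_lintegral_enorm (hU.sub hgi).aestronglyMeasurable
    simp only [Pi.sub_apply] at e hg
    rw [e]
    exact ENNReal.toReal_le_of_le_ofReal (by positivity) hg
  have hgd : Integrable (fun x => lineDeriv ℝ g x (-v)) μ := by
    refine (Continuous.integrable_of_hasCompactSupport
      (f := fun x => fderiv ℝ g x (-v)) ?_ ?_).congr (.of_forall fun x =>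
        ((hgs.differentiable (by simp) x).lineDeriv_eq_fderiv).symm)
    · exact (hgs.continuous_fderiv (by simp)).clm_apply continuous_const
    · exact hgc.fderiv_apply ℝ (-v)
  set M := ∫ x, ‖lineDeriv ℝ g x (-v)‖ ∂μ
  have hlim : Tendsto (fun k => M * ε k) atTop (𝓝 0) := by simpa using hε.const_mul M
  obtain ⟨N, hN⟩ := (Metric.tendsto_atTop.1 hlim) (δ / 2) (by positivity)
  refine ⟨N, fun k hk => ?_⟩
  -- the error of replacing `U` by the smooth `g`, and the part that can be integrated by parts
  have h1 : ∫ x, U x * lineDeriv ℝ (h k) x v ∂μ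
      = (∫ x, (U x - g x) * lineDeriv ℝ (h k) x v ∂μ) + ∫ x, lineDeriv ℝ g x (-v) * h k x ∂μ := by
    rw [← LipschitzWith.integral_lineDeriv_mul_eq (hK k) hD hgc,
      ← integral_add (f := fun x => (U x - g x) * lineDeriv ℝ (h k) x v)
        (integrable_mul_lineDeriv (hU.sub hgi) (hK k) v)]
    · congr 1; ext x; ring
    · simpa only [mul_comm] using integrable_mul_lineDeriv hgi (hK k) v
  have h2 : ‖∫ x, (U x - g x) * lineDeriv ℝ (h k) x v ∂μ‖ < δ / 2 := by
    calc _ ≤ ∫ x, (K * ‖v‖) * ‖U x - g x‖ ∂μ := by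
          refine norm_integral_le_of_norm_le ((hU.sub hgi).norm.const_mul _)
            (.of_forall fun x => ?_)
          rw [norm_mul, mul_comm]
          gcongr
          exact norm_lineDeriv_le_of_lipschitz ℝ (hK k)
      _ ≤ (K * ‖v‖) * (δ / (2 * (K * ‖v‖ + 1))) := by
          rw [integral_const_mul]; gcongr
      _ < (K * ‖v‖ + 1) * (δ / (2 * (K * ‖v‖ + 1))) := by gcongr; linarith
      _ = δ / 2 := by field_simp
  have h3 : ‖∫ x, lineDeriv ℝ g x (-v) * h k x ∂μ‖ ≤ M * ε k := by
    calc _ ≤ ∫ x, ‖lineDeriv ℝ g x (-v)‖ * ε k ∂μ := by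
          refine norm_integral_le_of_norm_le (hgd.norm.mul_const _) (.of_forall fun x => ?_)
          rw [norm_mul]
          gcongr
          exact hb k x
      _ = M * ε k := integral_mul_const _ _
  have h4 := hN k hk
  rw [Real.dist_eq, sub_zero] at h4
  rw [dist_zero_right, h1]
  linarith [norm_add_le (∫ x, (U x - g x) * lineDeriv ℝ (h k) x v ∂μ)
    (∫ x, lineDeriv ℝ g x (-v) * h k x ∂μ), le_abs_self (M * ε k)]

/-- Uniform smooth approximation of a Lipschitz function. Mollification does not increase the
Lipschitz constant. -/
theorem exists_contDiff_lipschitzWith_approx {F : Type*} [NormedAddCommGroup F] [NormedSpace ℝ F]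
    [CompleteSpace F] {φ : V → F} {K : ℝ≥0} (hφ : LipschitzWith K φ)
    {δ : ℝ} (hδ : 0 < δ) :
    ∃ ψ : V → F, ContDiff ℝ ∞ ψ ∧ LipschitzWith K ψ ∧ (∀ x, dist (ψ x) (φ x) ≤ δ) ∧
      Function.support ψ ⊆ cthickening δ (tsupport φ) := by
  let μ : Measure V := Measure.addHaar
  have hK : (0 : ℝ) < K + 1 := by positivity
  have hr : 0 < δ / (K + 1) := by positivity
  -- the radius makes `φ` vary by at most `δ` on the support of the kernel, even if `K = 0`
  let η : ContDiffBump (0 : V) := ⟨δ / (K + 1) / 2, δ / (K + 1), by positivity, by linarith⟩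
  have hint : ∀ x, Integrable (fun t => η.normed μ t • φ (x - t)) μ := fun x =>
    (((η.contDiff_normed (n := 0)).continuous).smul
      (hφ.continuous.comp (continuous_const.sub continuous_id))).integrable_of_hasCompactSupport
      η.hasCompactSupport_normed.smul_right
  refine ⟨η.normed μ ⋆[ContinuousLinearMap.lsmul ℝ ℝ, μ] φ, ?_, ?_, fun x => ?_, ?_⟩
  · exact η.hasCompactSupport_normed.contDiff_convolution_left _ η.contDiff_normed
      hφ.continuous.locallyIntegrable
  · refine LipschitzWith.of_dist_le_mul fun x y => ?_
    rw [dist_eq_norm]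
    simp only [convolution_def, ContinuousLinearMap.lsmul_apply]
    rw [← integral_sub (hint x) (hint y)]
    calc _ ≤ ∫ t, η.normed μ t * (K * dist x y) ∂μ := by
          refine norm_integral_le_of_norm_le (η.integrable_normed.mul_const _)
            (.of_forall fun t => ?_)
          rw [← smul_sub, norm_smul, Real.norm_of_nonneg (η.nonneg_normed t), ← dist_eq_norm]
          gcongr
          · exact η.nonneg_normed t
          · simpa using hφ.dist_le_mul (x - t) (y - t)
      _ = K * dist x y := by rw [integral_mul_const, η.integral_normed, one_mul]
  · refine ContDiffBump.dist_normed_convolution_le hφ.continuous.aestronglyMeasurable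
      fun y hy => ?_
    calc dist (φ y) (φ x) ≤ K * dist y x := hφ.dist_le_mul y x
      _ ≤ (K + 1) * (δ / (K + 1)) := by
          gcongr
          · linarith
          · exact (mem_ball.1 hy).le
      _ = δ := by field_simp
  · refine (support_convolution_subset _).trans ?_
    rintro _ ⟨t, ht, y, hy, rfl⟩
    rw [η.support_normed_eq, mem_ball_zero_iff] at ht
    refine mem_cthickening_of_dist_le _ y _ _ (subset_tsupport _ hy) ?_
    simp only [dist_eq_norm, add_sub_cancel_right]
    refine ht.le.trans (div_le_self hδ.le ?_)
    linarith [K.coe_nonneg]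

end Lipschitz

/-! ### The resolvent of `A A†` -/

section Resolvent

open ContinuousLinearMap
open scoped InnerProduct

variable {V W : Type*} [NormedAddCommGroup V] [InnerProductSpace ℝ V] [FiniteDimensional ℝ V]
  [NormedAddCommGroup W] [InnerProductSpace ℝ W] [FiniteDimensional ℝ W]

/-- The resolvent `(1 + A A†)⁻¹`; the operator inverted is always invertible
(`isUnit_one_add_comp_adjoint`). -/
noncomputable def resolventAt (A : V →L[ℝ] W) : W →L[ℝ] W :=
  Ring.inverse (1 + A ∘L A.adjoint)

theorem isUnit_one_add_comp_adjoint (A : V →L[ℝ] W) : IsUnit (1 + A ∘L A.adjoint) := by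
  refine isUnit_of_forall_le_norm_inner_map _ (c := 1) one_pos fun x => ?_
  refine le_trans ?_ (le_abs_self _)
  have : inner ℝ (A (A.adjoint x)) x = ‖A.adjoint x‖ ^ 2 := by
    rw [← adjoint_inner_right, real_inner_self_eq_norm_sq]
  simp [inner_add_left, this]

theorem resolventAt_add (A : V →L[ℝ] W) (y : W) :
    resolventAt A y + A (A.adjoint (resolventAt A y)) = y := by
  have h := Ring.mul_inverse_cancel _ (isUnit_one_add_comp_adjoint A)
  simpa [resolventAt] using congr($h y)

theorem resolventAt_apply_add (A : V →L[ℝ] W) (y : W) :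
    resolventAt A (y + A (A.adjoint y)) = y := by
  have h := Ring.inverse_mul_cancel _ (isUnit_one_add_comp_adjoint A)
  simpa [resolventAt] using congr($h y)

/-- The energy identity behind all norm bounds for the resolvent. -/
theorem inner_resolventAt (A : V →L[ℝ] W) (y : W) :
    inner ℝ y (resolventAt A y) = ‖resolventAt A y‖ ^ 2 + ‖A.adjoint (resolventAt A y)‖ ^ 2 := by
  have h : inner ℝ (resolventAt A y + A (A.adjoint (resolventAt A y))) (resolventAt A y)
      = ‖resolventAt A y‖ ^ 2 + ‖A.adjoint (resolventAt A y)‖ ^ 2 := by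
    rw [inner_add_left, ← adjoint_inner_right A, real_inner_self_eq_norm_sq,
      real_inner_self_eq_norm_sq]
  rwa [resolventAt_add] at h

theorem norm_resolventAt_apply_le (A : V →L[ℝ] W) (y : W) : ‖resolventAt A y‖ ≤ ‖y‖ := by
  have h := inner_resolventAt A y
  have h1 := real_inner_le_norm y (resolventAt A y)
  by_contra! hlt
  nlinarith [norm_nonneg y, norm_nonneg (resolventAt A y), sq_nonneg ‖A.adjoint (resolventAt A y)‖]

theorem norm_adjoint_resolventAt_apply_le (A : V →L[ℝ] W) (y : W) :
    ‖A.adjoint (resolventAt A y)‖ ≤ ‖y‖ := by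
  have h := inner_resolventAt A y
  have h1 := real_inner_le_norm y (resolventAt A y)
  have h2 := norm_resolventAt_apply_le A y
  refine abs_le_of_sq_le_sq' ?_ (norm_nonneg _) |>.2
  nlinarith [norm_nonneg y, norm_nonneg (resolventAt A y)]

theorem norm_resolventAt_map_le (A : V →L[ℝ] W) (v : V) : ‖resolventAt A (A v)‖ ≤ ‖v‖ := by
  have h := inner_resolventAt A (A v)
  rw [← adjoint_inner_right] at h
  have h1 := real_inner_le_norm v (A.adjoint (resolventAt A (A v)))
  refine abs_le_of_sq_le_sq' ?_ (norm_nonneg _) |>.2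
  nlinarith [sq_nonneg (‖v‖ - ‖A.adjoint (resolventAt A (A v))‖), 
    sq_nonneg ‖A.adjoint (resolventAt A (A v))‖, sq_nonneg ‖v‖]

theorem norm_adjoint_resolventAt_map_le (A : V →L[ℝ] W) (v : V) :
    ‖A.adjoint (resolventAt A (A v))‖ ≤ ‖v‖ := by
  have h := inner_resolventAt A (A v)
  rw [← adjoint_inner_right] at h
  have h1 := real_inner_le_norm v (A.adjoint (resolventAt A (A v)))
  by_contra! hlt
  nlinarith [norm_nonneg v, sq_nonneg ‖resolventAt A (A v)‖]

/-- The resolvent identity, with `B B† - A A†` split as `(B - A) B† + A (B - A)†`. Each factor `A`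
or `B†` stays next to a resolvent, so that the estimates do not involve the norms of `A` and
`B`. -/
theorem resolventAt_sub (A B : V →L[ℝ] W) (y : W) :
    resolventAt A y - resolventAt B y
      = resolventAt A ((B - A) (B.adjoint (resolventAt B y)))
        + resolventAt A (A ((B - A).adjoint (resolventAt B y))) := by
  conv_lhs =>
    rw [← resolventAt_apply_add A (resolventAt B y), ← map_sub]
    enter [2, 1]
    rw [← resolventAt_add B y]
  rw [← map_add]
  congr 1
  simp only [map_sub, sub_apply]
  abel

theorem norm_adjoint_apply_le (A : V →L[ℝ] W) (w : W) : ‖A.adjoint w‖ ≤ ‖A‖ * ‖w‖ := by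
  simpa using A.adjoint.le_opNorm w

theorem norm_resolventAt_sub_le (A B : V →L[ℝ] W) (y : W) :
    ‖resolventAt A y - resolventAt B y‖ ≤ 2 * ‖y‖ * ‖A - B‖ := by
  have h1 : ‖resolventAt A ((B - A) (B.adjoint (resolventAt B y)))‖ ≤ ‖B - A‖ * ‖y‖ :=
    (norm_resolventAt_apply_le _ _).trans (((B - A).le_opNorm _).trans
      (by gcongr; exact norm_adjoint_resolventAt_apply_le B y))
  have h2 : ‖resolventAt A (A ((B - A).adjoint (resolventAt B y)))‖ ≤ ‖B - A‖ * ‖y‖ :=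
    (norm_resolventAt_map_le _ _).trans ((norm_adjoint_apply_le _ _).trans
      (by gcongr; exact norm_resolventAt_apply_le B y))
  rw [resolventAt_sub, norm_sub_rev A B]
  linarith [norm_add_le (resolventAt A ((B - A) (B.adjoint (resolventAt B y))))
    (resolventAt A (A ((B - A).adjoint (resolventAt B y))))]

/-- `A ↦ A† (1 + A A†)⁻¹` is globally Lipschitz continuous. -/
theorem norm_adjoint_resolventAt_sub_le (A B : V →L[ℝ] W) (y : W) :
    ‖A.adjoint (resolventAt A y) - B.adjoint (resolventAt B y)‖ ≤ 3 * ‖y‖ * ‖A - B‖ := by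
  have e : A.adjoint (resolventAt A y) - B.adjoint (resolventAt B y)
      = A.adjoint (resolventAt A ((B - A) (B.adjoint (resolventAt B y))))
        + A.adjoint (resolventAt A (A ((B - A).adjoint (resolventAt B y))))
        + (A - B).adjoint (resolventAt B y) := by
    rw [← map_add, ← resolventAt_sub]
    simp
  have h1 : ‖A.adjoint (resolventAt A ((B - A) (B.adjoint (resolventAt B y))))‖ ≤ ‖B - A‖ * ‖y‖ :=
    (norm_adjoint_resolventAt_apply_le _ _).trans (((B - A).le_opNorm _).trans
      (by gcongr; exact norm_adjoint_resolventAt_apply_le B y))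
  have h2 : ‖A.adjoint (resolventAt A (A ((B - A).adjoint (resolventAt B y))))‖ ≤ ‖B - A‖ * ‖y‖ :=
    (norm_adjoint_resolventAt_map_le _ _).trans ((norm_adjoint_apply_le _ _).trans
      (by gcongr; exact norm_resolventAt_apply_le B y))
  have h3 : ‖(A - B).adjoint (resolventAt B y)‖ ≤ ‖A - B‖ * ‖y‖ :=
    (norm_adjoint_apply_le _ _).trans (by gcongr; exact norm_resolventAt_apply_le B y)
  rw [norm_sub_rev B A] at h1 h2
  rw [e]
  refine (norm_add₃_le).trans ?_
  linarith

/-- As `t → ∞`, the resolvents of `t A` converge to the orthogonal projection onto the complement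
of the range of `A`: they fix `ker A†` and are `O(t⁻¹)` on the range of `A`. -/
theorem tendsto_resolventAt_smul (A : V →L[ℝ] W) (y : W) :
    Tendsto (fun k : ℕ => resolventAt ((k + 1 : ℝ) • A) y) atTop
      (𝓝 ((LinearMap.range A.toLinearMap)ᗮ.starProjection y)) := by
  set R := LinearMap.range A.toLinearMap
  obtain ⟨v, hv⟩ : ∃ v, A v = R.starProjection y := R.starProjection_apply_mem y
  set q := Rᗮ.starProjection y with hq
  have hy : y = A v + q := by
    rw [hv, hq, Submodule.starProjection_add_starProjection_orthogonal]
  have hAq : A.adjoint q = 0 := by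
    refine ext_inner_left ℝ fun w => ?_
    rw [adjoint_inner_right, inner_zero_right]
    exact (Submodule.mem_orthogonal R q).1 (Rᗮ.starProjection_apply_mem y) _ ⟨w, rfl⟩
  have hfix : ∀ t : ℝ, resolventAt (t • A) q = q := fun t => by
    simpa [hAq] using resolventAt_apply_add (t • A) q
  rw [tendsto_iff_norm_sub_tendsto_zero]
  refine squeeze_zero (fun _ => norm_nonneg _) (fun k => ?_)
    (by simpa using tendsto_one_div_add_atTop_nhds_zero_nat.mul_const ‖v‖)
  have hk : (k + 1 : ℝ) ≠ 0 := by positivity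
  have e : resolventAt ((k + 1 : ℝ) • A) y - q
      = resolventAt ((k + 1 : ℝ) • A) (((k + 1 : ℝ) • A) ((k + 1 : ℝ)⁻¹ • v)) := by
    rw [hy, map_add, hfix, add_sub_cancel_right, smul_apply, map_smul A, smul_smul,
      mul_inv_cancel₀ hk, one_smul]
  rw [e]
  refine (norm_resolventAt_map_le _ _).trans_eq ?_
  rw [norm_smul, norm_inv, Real.norm_of_nonneg (by positivity)]

end Resolvent

/-! ### Divergence of Lipschitz fields -/

/-- A bounded bilinear map of two bounded Lipschitz functions is Lipschitz. -/
theorem lipschitzWith_clm_apply₂ {S X Y Z : Type*} [PseudoMetricSpace S]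
    [NormedAddCommGroup X] [NormedSpace ℝ X] [NormedAddCommGroup Y] [NormedSpace ℝ Y]
    [NormedAddCommGroup Z] [NormedSpace ℝ Z] (B : X →L[ℝ] Y →L[ℝ] Z) {f : S → X} {h : S → Y}
    {Kf Kh Mf Mh : ℝ≥0} (hf : LipschitzWith Kf f) (hh : LipschitzWith Kh h)
    (hfM : ∀ x, ‖f x‖ ≤ Mf) (hhM : ∀ x, ‖h x‖ ≤ Mh) :
    LipschitzWith (‖B‖₊ * (Kf * Mh + Mf * Kh)) fun x => B (f x) (h x) := by
  refine LipschitzWith.of_dist_le_mul fun x y => ?_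
  have e : B (f x) (h x) - B (f y) (h y) = B (f x - f y) (h x) + B (f y) (h x - h y) := by
    simp
  have h1 := B.le_opNorm₂ (f x - f y) (h x)
  have h2 := B.le_opNorm₂ (f y) (h x - h y)
  have h3 : ‖B‖ * ‖f x - f y‖ * ‖h x‖ ≤ ‖B‖ * (Kf * dist x y) * Mh := by
    gcongr
    · rw [← dist_eq_norm]; exact hf.dist_le_mul x y
    · exact hhM x
  have h4 : ‖B‖ * ‖f y‖ * ‖h x - h y‖ ≤ ‖B‖ * Mf * (Kh * dist x y) := by
    gcongr
    · exact hfM y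
    · rw [← dist_eq_norm]; exact hh.dist_le_mul x y
  rw [dist_eq_norm, e]
  push_cast
  linarith [norm_add_le (B (f x - f y) (h x)) (B (f y) (h x - h y))]

section Divergence

variable {n : ℕ}

theorem lipschitzWith_coord {V : E n → E n} {K : ℝ≥0} (hV : LipschitzWith K V) (i : Fin n) :
    LipschitzWith K fun x => V x i := by
  refine LipschitzWith.of_dist_le_mul fun x y => ?_
  refine le_trans ?_ (hV.dist_le_mul x y)
  rw [dist_eq_norm, dist_eq_norm]
  exact PiLp.norm_apply_le (V x - V y) i

/-- The two sides may differ where `V` is not differentiable: `fderiv` is zero there, whereas line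
derivatives may exist. -/
theorem ae_divergence_eq_sum_lineDeriv {V : E n → E n} {K : ℝ≥0} (hV : LipschitzWith K V) :
    ∀ᵐ x, divergence V x
      = ∑ i, lineDeriv ℝ (fun y => V y i) x (EuclideanSpace.single i 1) := by
  filter_upwards [hV.ae_differentiableAt] with x hx
  refine Finset.sum_congr rfl fun i _ => ?_
  have h : HasFDerivAt (fun y => V y i)
      ((EuclideanSpace.proj i : E n →L[ℝ] ℝ) ∘L fderiv ℝ V x) x :=
    (EuclideanSpace.proj i : E n →L[ℝ] ℝ).hasFDerivAt.comp x hx.hasFDerivAt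
  rw [(h.hasLineDerivAt _).lineDeriv]
  rfl

theorem integrable_mul_divergence {U : E n → ℝ} (hU : Integrable U) {V : E n → E n} {K : ℝ≥0}
    (hV : LipschitzWith K V) : Integrable fun x => U x * divergence V x := by
  refine (integrable_finsetSum Finset.univ fun i _ => integrable_mul_lineDeriv hU
    (lipschitzWith_coord hV i) (EuclideanSpace.single i (1 : ℝ))).congr ?_
  filter_upwards [ae_divergence_eq_sum_lineDeriv hV] with x hx
  rw [hx, Finset.mul_sum]

theorem integral_mul_divergence_sub {U : E n → ℝ} (hU : Integrable U) {V V' : E n → E n}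
    {K K' : ℝ≥0} (hV : LipschitzWith K V) (hV' : LipschitzWith K' V') :
    ∫ x, U x * divergence (fun y => V y - V' y) x
      = (∫ x, U x * divergence V x) - ∫ x, U x * divergence V' x := by
  rw [← integral_sub (integrable_mul_divergence hU hV) (integrable_mul_divergence hU hV')]
  refine integral_congr_ae ?_
  filter_upwards [hV.ae_differentiableAt, hV'.ae_differentiableAt] with x hx hx'
  simp only [divergence]
  rw [fderiv_fun_sub hx hx', ← mul_sub, ← Finset.sum_sub_distrib]
  simp

/-- Divergences of equi-Lipschitz fields that converge uniformly to zero tend to zero weakly-* in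
`L^∞`. -/
theorem tendsto_integral_mul_divergence_zero {U : E n → ℝ} (hU : Integrable U)
    {V : ℕ → E n → E n} {K : ℝ≥0} (hK : ∀ k, LipschitzWith K (V k)) {ε : ℕ → ℝ}
    (hε : Tendsto ε atTop (𝓝 0)) (hb : ∀ k x, ‖V k x‖ ≤ ε k) :
    Tendsto (fun k => ∫ x, U x * divergence (V k) x) atTop (𝓝 0) := by
  have e : ∀ k, ∫ x, U x * divergence (V k) x
      = ∑ i, ∫ x, U x * lineDeriv ℝ (fun y => V k y i) x (EuclideanSpace.single i 1) := by
    intro k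
    rw [← integral_finsetSum _ fun i _ => integrable_mul_lineDeriv hU
      (lipschitzWith_coord (hK k) i) (EuclideanSpace.single i (1 : ℝ))]
    refine integral_congr_ae ?_
    filter_upwards [ae_divergence_eq_sum_lineDeriv (hK k)] with x hx
    rw [hx, Finset.mul_sum]
  simp_rw [e]
  rw [show (0 : ℝ) = ∑ _i : Fin n, (0 : ℝ) by simp]
  exact tendsto_finsetSum _ fun i _ => tendsto_integral_mul_lineDeriv_zero hU
    (fun k => lipschitzWith_coord (hK k) i) hε
    (fun k x => (PiLp.norm_apply_le (V k x) i).trans (hb k x)) _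

end Divergence

/-! ### Lipschitz test fields and the range of the coefficients -/

section TestFields

variable {m n : ℕ}

/-- Dominated convergence for fields supported in a common set. The limit `φ'` need not be
continuous. -/
theorem tendsto_integral_inner {A K : Set (E n)} {g : E n → E m} (hKc : IsClosed K) (hKA : K ⊆ A)
    (hg : IntegrableOn g K) {φ : ℕ → E n → E m} {φ' : E n → E m} (hc : ∀ k, Continuous (φ k))
    (hK : ∀ k, Function.support (φ k) ⊆ K) {M : ℝ} (hM : ∀ k x, ‖φ k x‖ ≤ M)
    (hlim : ∀ x, Tendsto (fun k => φ k x) atTop (𝓝 (φ' x))) :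
    Tendsto (fun k => ∫ x in A, inner ℝ (g x) (φ k x)) atTop
      (𝓝 (∫ x in A, inner ℝ (g x) (φ' x))) := by
  have hK' : Function.support φ' ⊆ K := fun x hx => by
    by_contra h
    refine hx (tendsto_nhds_unique (hlim x) ?_)
    have : ∀ k, φ k x = 0 := fun k => by
      by_contra h0
      exact h (hK k h0)
    simp [this]
  rw [integral_inner_eq_of_tsupport hKA (closure_minimal hK' hKc)]
  simp_rw [fun k => integral_inner_eq_of_tsupport hKA (closure_minimal (hK k) hKc) g]
  refine tendsto_integral_of_dominated_convergence (fun x => ‖g x‖ * M)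
    (fun k => hg.aestronglyMeasurable.inner (hc k).aestronglyMeasurable) (hg.norm.mul_const M)
    (fun k => .of_forall fun x => ?_) (.of_forall fun x => tendsto_const_nhds.inner (hlim x))
  exact (norm_inner_le_norm _ _).trans (by gcongr; exact hM k x)

/-- If the integration by parts formula that defines the `X`-gradient holds for smooth test
fields, it holds for Lipschitz continuous ones. -/
theorem integral_mul_divergence_adjoint_of_lipschitz {A : Set (E n)} (hA : IsOpen A)
    {U : E n → ℝ} (hU : Integrable U) {g : E n → E m} (hg : LocallyIntegrableOn g A)
    {L : E n → E m →L[ℝ] E n} {KL R : ℝ≥0} (hL : LipschitzWith KL L) (hR : ∀ x, ‖L x‖ ≤ R)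
    (hsmooth : ∀ φ : E n → E m, IsTestField A φ →
      - ∫ x, U x * divergence (fun y => L y (φ y)) x = ∫ x in A, inner ℝ (g x) (φ x))
    {φ : E n → E m} {K : ℝ≥0} (hφ : LipschitzWith K φ) (hc : HasCompactSupport φ)
    (hφA : tsupport φ ⊆ A) :
    - ∫ x, U x * divergence (fun y => L y (φ y)) x = ∫ x in A, inner ℝ (g x) (φ x) := by
  obtain ⟨δ, hδ, hδA⟩ := IsCompact.exists_cthickening_subset_open hc hA hφA
  have hKc : IsCompact (cthickening δ (tsupport φ)) := IsCompact.cthickening hc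
  obtain ⟨M, hM⟩ := hc.exists_bound_of_continuous hφ.continuous
  have hM0 : 0 ≤ M := (norm_nonneg _).trans (hM 0)
  let d : ℕ → ℝ := fun k => δ * (1 / ((k : ℝ) + 1))
  have hd0 : ∀ k, 0 < d k := fun k => by positivity
  have hdδ : ∀ k, d k ≤ δ := fun k => mul_le_of_le_one_right hδ.le (by
    rw [div_le_one (by positivity)]; linarith [(Nat.cast_nonneg k : (0 : ℝ) ≤ k)])
  have hd : Tendsto d atTop (𝓝 0) := by
    simpa [d] using tendsto_one_div_add_atTop_nhds_zero_nat.const_mul δ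
  choose ψ hψs hψK hψd hψsupp using
    fun k => exists_contDiff_lipschitzWith_approx hφ (hd0 k)
  have hsupp : ∀ k, Function.support (ψ k) ⊆ cthickening δ (tsupport φ) := fun k =>
    (hψsupp k).trans (cthickening_mono (hdδ k) _)
  have htest : ∀ k, IsTestField A (ψ k) := fun k =>
    ⟨hψs k, HasCompactSupport.of_support_subset_isCompact hKc (hsupp k),
      (closure_minimal (hsupp k) hKc.isClosed).trans hδA⟩
  have hsubM : ∀ k x, ‖ψ k x - φ x‖ ≤ d k := fun k x => by
    rw [← dist_eq_norm]; exact hψd k x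
  have hψM : ∀ k x, ‖ψ k x‖ ≤ M + δ := fun k x => by
    have := norm_le_norm_add_norm_sub' (ψ k x) (φ x)
    linarith [hM x, hsubM k x, hdδ k]
  have hlim : ∀ x, Tendsto (fun k => ψ k x) atTop (𝓝 (φ x)) := fun x => by
    rw [tendsto_iff_dist_tendsto_zero]
    exact squeeze_zero (fun _ => dist_nonneg) (fun k => hψd k x) hd
  have hR1 := tendsto_integral_inner hKc.isClosed hδA
    (hg.integrableOn_compact_subset hδA hKc) (fun k => (hψs k).continuous) hsupp hψM hlim
  have hLψ : ∀ k, LipschitzWith _ fun x => L x (ψ k x) := fun k =>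
    lipschitzWith_clm_apply₂ (ContinuousLinearMap.id ℝ (E m →L[ℝ] E n)) hL (hψK k) hR
      (Mh := ⟨M + δ, by positivity⟩) (hψM k)
  have hLφ : LipschitzWith _ fun x => L x (φ x) :=
    lipschitzWith_clm_apply₂ (ContinuousLinearMap.id ℝ (E m →L[ℝ] E n)) hL hφ hR
      (Mh := ⟨M, hM0⟩) hM
  -- `L (ψ k - φ)` is equi-Lipschitz in `k` because `ψ k` has the Lipschitz constant of `φ`
  have hdiff := tendsto_integral_mul_divergence_zero hU
    (V := fun k x => L x (ψ k x) - L x (φ x)) (fun k => (hLψ k).sub hLφ)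
    (ε := fun k => R * d k) (by simpa using hd.const_mul (R : ℝ)) (fun k x => by
      rw [← map_sub]
      exact ((L x).le_opNorm _).trans (by gcongr; exacts [hR x, hsubM k x]))
  simp_rw [fun k => integral_mul_divergence_sub hU (hLψ k) hLφ] at hdiff
  have hL1 : Tendsto (fun k => ∫ x, U x * divergence (fun y => L y (ψ k y)) x) atTop
      (𝓝 (∫ x, U x * divergence (fun y => L y (φ y)) x)) := by
    simpa using hdiff.add_const (∫ x, U x * divergence (fun y => L y (φ y)) x)
  refine tendsto_nhds_unique hL1.neg ?_
  simpa only [fun k => hsmooth (ψ k) (htest k)] using hR1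

/-- The `X`-gradient takes its values in the range of the coefficient matrix, here for globally
Lipschitz and bounded coefficients `L`. The fields `ψ (1 + k² L L†)⁻¹ e` are admissible in the
integration by parts formula; their images under `L†` are equi-Lipschitz and of size `O(1/k)`, so
that the left-hand side vanishes in the limit, while the fields themselves converge to the
projection of `ψ e` onto the orthogonal complement of the range of `L`. -/
theorem ae_mem_range_of_integral_eq {A : Set (E n)} (hA : IsOpen A)
    {U : E n → ℝ} (hU : Integrable U) {g : E n → E m} (hg : LocallyIntegrableOn g A)
    {L : E n → E n →L[ℝ] E m} {KL R : ℝ≥0} (hL : LipschitzWith KL L) (hR : ∀ x, ‖L x‖ ≤ R)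
    (hsmooth : ∀ φ : E n → E m, IsTestField A φ →
      - ∫ x, U x * divergence (fun y => (L y).adjoint (φ y)) x
        = ∫ x in A, inner ℝ (g x) (φ x)) :
    ∀ᵐ x, x ∈ A → g x ∈ LinearMap.range (L x).toLinearMap := by
  let N : ℕ → ℝ := fun k => k + 1
  have hN : ∀ k, 0 < N k := fun k => by positivity
  let S : E m → ℕ → E n → E m := fun e k x => resolventAt (N k • L x) e
  let P : E m → E n → E m := fun e x =>
    (LinearMap.range (L x).toLinearMap)ᗮ.starProjection e
  have hSP : ∀ e x, Tendsto (fun k => S e k x) atTop (𝓝 (P e x)) := fun e x =>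
    tendsto_resolventAt_smul (L x) e
  have hSe : ∀ e k x, ‖S e k x‖ ≤ ‖e‖₊ := fun e k x => norm_resolventAt_apply_le _ _
  have hNL : ∀ k x y, ‖N k • L x - N k • L y‖ ≤ N k * (KL * dist x y) := fun k x y => by
    rw [(smul_sub (N k) (L x) (L y)).symm, norm_smul, Real.norm_of_nonneg (hN k).le,
      ← dist_eq_norm]
    gcongr
    exact hL.dist_le_mul x y
  have hSlip : ∀ e k, LipschitzWith (2 * ‖e‖₊ * ((N k).toNNReal * KL)) (S e k) := fun e k => by
    refine LipschitzWith.of_dist_le_mul fun x y => ?_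
    rw [dist_eq_norm]
    refine (norm_resolventAt_sub_le _ _ e).trans ?_
    refine (mul_le_mul_of_nonneg_left (hNL k x y) (by positivity)).trans_eq ?_
    push_cast
    rw [Real.coe_toNNReal _ (hN k).le]
    ring
  -- `L† S` is rewritten with `(N L)†` in order to use the estimates that do not depend on `N`
  have hW : ∀ e k x, (L x).adjoint (S e k x)
      = (N k)⁻¹ • (N k • L x).adjoint (resolventAt (N k • L x) e) := fun e k x => by
    simp [S, smul_smul, inv_mul_cancel₀ (hN k).ne']
  have hWlip : ∀ e k, LipschitzWith (3 * ‖e‖₊ * KL) fun x => (L x).adjoint (S e k x) :=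
    fun e k => by
      refine LipschitzWith.of_dist_le_mul fun x y => ?_
      rw [dist_eq_norm, hW, hW, ← smul_sub, norm_smul, norm_inv, Real.norm_of_nonneg (hN k).le]
      have h1 := (norm_adjoint_resolventAt_sub_le (N k • L x) (N k • L y) e).trans
        (mul_le_mul_of_nonneg_left (hNL k x y) (by positivity))
      rw [inv_mul_le_iff₀ (hN k)]
      refine h1.trans_eq ?_
      push_cast
      ring
  have hWb : ∀ e k x, ‖(L x).adjoint (S e k x)‖ ≤ ‖e‖ * (1 / N k) := fun e k x => by
    rw [hW, norm_smul, norm_inv, Real.norm_of_nonneg (hN k).le, one_div, mul_comm]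
    gcongr
    exact norm_adjoint_resolventAt_apply_le _ _
  have hN1 : ∀ k, 1 / N k ≤ 1 := fun k => by
    rw [div_le_one (hN k)]; simp [N]
  have hNlim : Tendsto (fun k => 1 / N k) atTop (𝓝 0) := tendsto_one_div_add_atTop_nhds_zero_nat
  have hadj : LipschitzWith KL fun x => (L x).adjoint := by
    refine LipschitzWith.of_dist_le_mul fun x y => ?_
    rw [LinearIsometryEquiv.dist_map]
    exact hL.dist_le_mul x y
  have hadjR : ∀ x, ‖(L x).adjoint‖ ≤ R := fun x => by simpa using hR x
  have hPmeas : ∀ e, AEStronglyMeasurable (P e) (volume : Measure (E n)) := fun e =>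
    aestronglyMeasurable_of_tendsto_ae atTop
      (fun k => (hSlip e k).continuous.aestronglyMeasurable) (.of_forall (hSP e))
  have hPn : ∀ e x, ‖P e x‖ ≤ ‖e‖ := fun e x => Submodule.norm_starProjection_apply_le _ _
  have hzero : ∀ e : E m, ∀ᵐ x, x ∈ A → inner ℝ (g x) (P e x) = 0 := by
    intro e
    have hloc : LocallyIntegrableOn (fun x => inner ℝ (g x) (P e x)) A := fun x hx => by
      obtain ⟨s, hs, hgs⟩ := hg x hx
      refine ⟨s, hs, Integrable.mono' (hgs.norm.mul_const ‖e‖)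
        (hgs.aestronglyMeasurable.inner (hPmeas e).restrict) (.of_forall fun y => ?_)⟩
      exact (norm_inner_le_norm _ _).trans (by gcongr; exact hPn e y)
    refine hA.ae_eq_zero_of_integral_contDiff_smul_eq_zero hloc fun ψ hψ hψc hψA => ?_
    obtain ⟨Kψ, hψK⟩ := hψ.lipschitzWith_of_hasCompactSupport hψc (by simp)
    obtain ⟨M, hM⟩ := hψc.exists_bound_of_continuous hψ.continuous
    have hM0 : 0 ≤ M := (norm_nonneg _).trans (hM 0)
    let φ : ℕ → E n → E m := fun k x => ψ x • S e k x
    have hφlip : ∀ k, LipschitzWith _ (φ k) := fun k =>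
      lipschitzWith_clm_apply₂ (ContinuousLinearMap.lsmul ℝ ℝ) hψK (hSlip e k)
        (Mf := ⟨M, hM0⟩) hM (hSe e k)
    have hφsupp : ∀ k, Function.support (φ k) ⊆ tsupport ψ := fun k x hx =>
      subset_tsupport ψ fun h => hx (by simp [φ, h])
    have hφts : ∀ k, tsupport (φ k) ⊆ tsupport ψ := fun k =>
      closure_minimal (hφsupp k) (isClosed_tsupport ψ)
    have hident : ∀ k, - ∫ x, U x * divergence (fun y => (L y).adjoint (φ k y)) x
        = ∫ x in A, inner ℝ (g x) (φ k x) := fun k =>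
      integral_mul_divergence_adjoint_of_lipschitz hA hU hg hadj hadjR hsmooth (hφlip k)
        (HasCompactSupport.of_support_subset_isCompact hψc (hφsupp k)) ((hφts k).trans hψA)
    have hright : Tendsto (fun k => ∫ x in A, inner ℝ (g x) (φ k x)) atTop
        (𝓝 (∫ x in A, inner ℝ (g x) (ψ x • P e x))) := by
      refine tendsto_integral_inner (isClosed_tsupport ψ) hψA
        (hg.integrableOn_compact_subset hψA hψc) (fun k => (hφlip k).continuous) hφsupp
        (M := M * ‖e‖) (fun k x => ?_) (fun x => (hSP e x).const_smul (ψ x))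
      rw [norm_smul]
      gcongr
      exacts [hM x, hSe e k x]
    have hleft : Tendsto (fun k => ∫ x, U x * divergence (fun y => (L y).adjoint (φ k y)) x) atTop
        (𝓝 0) := by
      have eφ : ∀ k, (fun y => (L y).adjoint (φ k y))
          = fun y => ContinuousLinearMap.lsmul ℝ ℝ (ψ y) ((L y).adjoint (S e k y)) := fun k => by
        ext1 y; simp [φ]
      have hVlip : ∀ k, LipschitzWith _ fun y =>
          ContinuousLinearMap.lsmul ℝ ℝ (ψ y) ((L y).adjoint (S e k y)) := fun k =>
        lipschitzWith_clm_apply₂ (ContinuousLinearMap.lsmul ℝ ℝ) hψK (hWlip e k)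
          (Mf := ⟨M, hM0⟩) hM (Mh := ‖e‖₊)
          (fun x => (hWb e k x).trans (mul_le_of_le_one_right (norm_nonneg e) (hN1 k)))
      simp_rw [eφ]
      refine tendsto_integral_mul_divergence_zero hU hVlip
        (ε := fun k => M * (‖e‖ * (1 / N k))) (by simpa using (hNlim.const_mul ‖e‖).const_mul M)
        (fun k x => ?_)
      rw [ContinuousLinearMap.lsmul_apply, norm_smul]
      gcongr
      exacts [hM x, hWb e k x]
    have h0 : ∫ x in A, inner ℝ (g x) (ψ x • P e x) = 0 := by
      refine tendsto_nhds_unique hright ?_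
      simpa only [hident, neg_zero] using hleft.neg
    rw [← h0, ← setIntegral_eq_integral_of_forall_compl_eq_zero (s := A)
      (fun x hx => by simp [image_eq_zero_of_notMem_tsupport (fun h => hx (hψA h))])]
    simp only [inner_smul_right, smul_eq_mul]
  filter_upwards [ae_all_iff.2 fun j : Fin m => hzero (EuclideanSpace.single j 1)] with x hx hxA
  have hPg : (LinearMap.range (L x).toLinearMap)ᗮ.starProjection (g x) = 0 := by
    ext j
    have := hx j hxA
    rw [← Submodule.inner_starProjection_left_eq_right, EuclideanSpace.inner_single_right] at this
    simpa using this
  rwa [Submodule.starProjection_apply_eq_zero_iff, Submodule.orthogonal_orthogonal] at hPg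

end TestFields

/-! ### The `X`-gradient and the functional -/

section Coefficients

variable {m n : ℕ}

/-- A matrix as a continuous linear map `ξ ↦ M ξ` between Euclidean spaces, linearly in `M`. -/
noncomputable def matrixCLM (m n : ℕ) : Matrix (Fin m) (Fin n) ℝ →ₗ[ℝ] (E n →L[ℝ] E m) :=
  (LinearMap.toContinuousLinearMap (𝕜 := ℝ) (E := E n) (F' := E m)).toLinearMap ∘ₗ
    (Matrix.toEuclideanLin (𝕜 := ℝ) (m := Fin m) (n := Fin n)).toLinearMap

theorem matrixCLM_apply (M : Matrix (Fin m) (Fin n) ℝ) (ξ : E n) :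
    matrixCLM m n M ξ = WithLp.toLp 2 (M *ᵥ ξ.ofLp) := rfl

theorem adjoint_matrixCLM_apply (M : Matrix (Fin m) (Fin n) ℝ) (η : E m) :
    (matrixCLM m n M).adjoint η = WithLp.toLp 2 (η.ofLp ᵥ* M) := by
  refine ext_inner_left ℝ fun ξ => ?_
  rw [ContinuousLinearMap.adjoint_inner_right, matrixCLM_apply]
  simp only [EuclideanSpace.inner_eq_star_dotProduct, star_trivial]
  rw [Matrix.dotProduct_mulVec, dotProduct_comm]

/-- Lipschitz coefficients on a bounded set extend to globally Lipschitz and bounded ones: each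
entry is extended and then truncated at a bound for it on the set. -/
theorem IsLipschitzFamily.exists_extension {C : CoeffMatrix m n} {Ω : Set (E n)}
    (hC : IsLipschitzFamily C Ω) (hΩ : Bornology.IsBounded Ω) :
    ∃ (L : E n → E n →L[ℝ] E m) (K R : ℝ≥0), LipschitzWith K L ∧ (∀ x, ‖L x‖ ≤ R) ∧
      ∀ x ∈ Ω, L x = matrixCLM m n (C x) := by
  have hentry : ∀ j i, ∃ (c : E n → ℝ) (K M : ℝ≥0), LipschitzWith K c ∧ (∀ x, |c x| ≤ M) ∧
      EqOn (fun x => C x j i) c Ω := by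
    intro j i
    obtain ⟨K, hK⟩ := hC j i
    obtain ⟨c, hc, hcC⟩ := hK.extend_real
    obtain ⟨M, hM⟩ := (hc.isBounded_image hΩ).exists_norm_le
    refine ⟨fun x => max (-(M.toNNReal : ℝ)) (min M.toNNReal (c x)), K, M.toNNReal,
      (hc.const_min _).const_max _, fun x => ?_, fun x hx => ?_⟩
    · exact abs_le.2 ⟨le_max_left _ _, max_le (by linarith [M.toNNReal.coe_nonneg])
        (min_le_left _ _)⟩
    · have h1 := abs_le.1 ((hM (c x) ⟨x, hx, rfl⟩).trans (Real.le_coe_toNNReal M))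
      simp only
      rw [min_eq_right h1.2, max_eq_right h1.1]
      exact hcC hx
  choose c K M hcK hcM hcC using hentry
  let T : (Fin m → Fin n → ℝ) →L[ℝ] (E n →L[ℝ] E m) :=
    LinearMap.toContinuousLinearMap (matrixCLM m n ∘ₗ (Matrix.ofLinearEquiv ℝ).toLinearMap)
  have hlip : LipschitzWith (∑ j, ∑ i, K j i)
      fun x => (fun j i => c j i x : Fin m → Fin n → ℝ) := by
    refine LipschitzWith.of_dist_le_mul fun x y => ?_
    refine (dist_pi_le_iff (by positivity)).2 fun j =>
      (dist_pi_le_iff (by positivity)).2 fun i => ?_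
    refine ((hcK j i).dist_le_mul x y).trans ?_
    gcongr
    exact (Finset.single_le_sum (f := fun i => K j i) (fun _ _ => zero_le)
      (Finset.mem_univ i)).trans (Finset.single_le_sum (f := fun j => ∑ i, K j i)
        (fun _ _ => zero_le) (Finset.mem_univ j))
  have hbd : ∀ x, ‖(fun j i => c j i x : Fin m → Fin n → ℝ)‖ ≤ (∑ j, ∑ i, M j i : ℝ≥0) := by
    intro x
    refine (pi_norm_le_iff_of_nonneg (by positivity)).2 fun j =>
      (pi_norm_le_iff_of_nonneg (by positivity)).2 fun i => ?_
    refine (hcM j i x).trans ?_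
    norm_cast
    exact (Finset.single_le_sum (f := fun i => M j i) (fun _ _ => zero_le)
      (Finset.mem_univ i)).trans (Finset.single_le_sum (f := fun j => ∑ i, M j i)
        (fun _ _ => zero_le) (Finset.mem_univ j))
  refine ⟨fun x => T fun j i => c j i x, _, ‖T‖₊ * ∑ j, ∑ i, M j i, T.lipschitz.comp hlip,
    fun x => ?_, fun x hx => ?_⟩
  · push_cast
    refine (T.le_opNorm _).trans ?_
    gcongr
    exact_mod_cast hbd x
  · change matrixCLM m n (Matrix.of fun j i => c j i x) = _
    congr 1
    ext j i
    exact (hcC j i hx).symm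

/-- The `X`-gradient lies almost everywhere in the range of the coefficient matrix. -/
theorem IsXGradient.ae_exists_act {C : CoeffMatrix m n} {Ω A : Set (E n)}
    (hΩ : Bornology.IsBounded Ω) (hC : IsLipschitzFamily C Ω) (hA : IsOpen A) (hAΩ : A ⊆ Ω)
    {u : E n → ℝ} (hu : IntegrableOn u A) {g : E n → E m} (hg : IsXGradient C A u g) :
    ∀ᵐ x, x ∈ A → ∃ ξ, C.act x ξ = g x := by
  obtain ⟨L, K, R, hL, hR, hLC⟩ := hC.exists_extension hΩ
  have hU : Integrable (A.indicator u) := (integrable_indicator_iff hA.measurableSet).2 hu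
  have hsmooth : ∀ φ : E n → E m, IsTestField A φ →
      - ∫ x, A.indicator u x * divergence (fun y => (L y).adjoint (φ y)) x
        = ∫ x in A, inner ℝ (g x) (φ x) := by
    intro φ hφ
    rw [← hg.2 φ hφ, xGradDistribution, ← integral_indicator hA.measurableSet]
    congr 2
    ext x
    by_cases hx : x ∈ A
    · have h : C.pullField φ =ᶠ[𝓝 x] fun y => (L y).adjoint (φ y) := by
        filter_upwards [hA.mem_nhds hx] with y hy
        rw [hLC y (hAΩ hy), adjoint_matrixCLM_apply]
        rfl
      simp [hx, divergence, h.fderiv_eq]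
    · simp [hx]
  filter_upwards [ae_mem_range_of_integral_eq hA hU hg.1 hL hR hsmooth] with x hx hxA
  obtain ⟨ξ, hξ⟩ := hx hxA
  refine ⟨ξ, ?_⟩
  rw [← hξ, hLC x (hAΩ hxA)]
  rfl

theorem functional_eq_lintegral {C : CoeffMatrix m n} {Ω : Set (E n)} {p : ℝ}
    {f : E n → ℝ → E m → ℝ≥0∞} {u : Lp ℝ (ENNReal.ofReal p) (volume.restrict Ω)} {A : Set (E n)}
    (hA : IsOpen A) (hAΩ : A ⊆ Ω) (hu : MemWLoc C A p u) :
    functional C Ω p f u A = ∫⁻ x in A, f x (u x) (xGrad C A u x) :=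
  if_pos ⟨hA, hAΩ, hu⟩

/-- A property that holds at almost every point for all vectors in the range of the coefficient
matrix holds almost everywhere along the `X`-gradient. -/
theorem ae_restrict_xGrad {C : CoeffMatrix m n} {Ω A : Set (E n)} (hΩ : Bornology.IsBounded Ω)
    (hC : IsLipschitzFamily C Ω) {p : ℝ} (hp : 1 ≤ p) (hA : IsOpen A) (hAΩ : A ⊆ Ω)
    (u : Lp ℝ (ENNReal.ofReal p) (volume.restrict Ω)) (hu : MemWLoc C A p u)
    {Q : E n → ℝ → E m → Prop}
    (hQ : ∀ᵐ x ∂(volume.restrict Ω), ∀ (s : ℝ) (ξ : E n), Q x s (C.act x ξ)) :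
    ∀ᵐ x ∂(volume.restrict A), Q x (u x) (xGrad C A u x) := by
  have : IsFiniteMeasure ((volume : Measure (E n)).restrict Ω) :=
    isFiniteMeasure_restrict.2 hΩ.measure_lt_top.ne
  have huI : IntegrableOn u A :=
    IntegrableOn.mono_set ((Lp.memLp u).integrable (by simpa using hp)) hAΩ
  filter_upwards [ae_restrict_of_ae_restrict_of_subset hAΩ hQ, ae_restrict_mem hA.measurableSet,
    ae_restrict_of_ae ((hu.isXGradient_xGrad hA).ae_exists_act hΩ hC hA hAΩ huI)] with x hx hxA hξ
  obtain ⟨ξ, hξ⟩ := hξ hxA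
  rw [← hξ]
  exact hx _ ξ

end Coefficients

end Anisotropic

theorem mainTheorem4 {m n : ℕ} (hm : 0 < m) (hmn : m ≤ n)
    (Ω : Set (E n)) (hΩ : IsOpen Ω) (hΩb : Bornology.IsBounded Ω)
    (C : CoeffMatrix m n) (hC : IsLipschitzFamily C Ω)
    (p : ℝ) (hp : 1 ≤ p)
    (f : E n → ℝ → E m → ℝ≥0∞) (hf : IsCaratheodory Ω f) :
    -- (i) growth
    (∀ (a : E n → ℝ) (b c : ℝ), LocallyIntegrableOn a Ω → 0 ≤ b → 0 ≤ c →
      (∀ᵐ x ∂(volume.restrict Ω), ∀ (s : ℝ) (ξ : E n),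
        f x s (C.act x ξ) ≤ ENNReal.ofReal (a x + b * |s| ^ p + c * ‖C.act x ξ‖ ^ p)) →
      ∀ (A : Set (E n)) (u : Lp ℝ (ENNReal.ofReal p) (volume.restrict Ω)),
        IsOpen A → A ⊆ Ω → MemWLoc C A p u →
        functional C Ω p f u A ≤
          ∫⁻ x in A, ENNReal.ofReal (a x + b * |u x| ^ p + c * ‖xGrad C A u x‖ ^ p)) ∧
    -- (ii) coercivity
    (∀ d : ℝ, 0 < d →
      (∀ᵐ x ∂(volume.restrict Ω), ∀ (s : ℝ) (ξ : E n),
        ENNReal.ofReal (d * ‖C.act x ξ‖ ^ p) ≤ f x s (C.act x ξ)) →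
      ∀ (A : Set (E n)) (u : Lp ℝ (ENNReal.ofReal p) (volume.restrict Ω)),
        IsOpen A → A ⊆ Ω → MemWLoc C A p u →
        ENNReal.ofReal d * ∫⁻ x in A, ENNReal.ofReal (‖xGrad C A u x‖ ^ p) ≤
          functional C Ω p f u A) ∧
    -- (iii) dependence on the restriction to the range only
    (∀ g : E n → ℝ → E m → ℝ≥0∞, IsCaratheodory Ω g →
      (∀ᵐ x ∂(volume.restrict Ω), ∀ (s : ℝ) (ξ : E n),
        f x s (C.act x ξ) = g x s (C.act x ξ)) →
      ∀ (A : Set (E n)) (u : Lp ℝ (ENNReal.ofReal p) (volume.restrict Ω)),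
        IsOpen A → A ⊆ Ω → MemWLoc C A p u →
        functional C Ω p f u A = ∫⁻ x in A, g x (u x) (xGrad C A u x)) := by
  refine ⟨fun a b c _ _ _ hfa A u hA hAΩ hu => ?_, fun d hd hfd A u hA hAΩ hu => ?_,
    fun g _ hfg A u hA hAΩ hu => ?_⟩ <;> rw [functional_eq_lintegral hA hAΩ hu]
  · exact lintegral_mono_ae (ae_restrict_xGrad hΩb hC hp hA hAΩ u hu
      (Q := fun x s η => f x s η ≤ ENNReal.ofReal (a x + b * |s| ^ p + c * ‖η‖ ^ p)) hfa)
  · rw [← lintegral_const_mul' _ _ ENNReal.ofReal_ne_top]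
    simp_rw [← ENNReal.ofReal_mul hd.le]
    exact lintegral_mono_ae (ae_restrict_xGrad hΩb hC hp hA hAΩ u hu
      (Q := fun x s η => ENNReal.ofReal (d * ‖η‖ ^ p) ≤ f x s η) hfd)
  · exact lintegral_congr_ae (ae_restrict_xGrad hΩb hC hp hA hAΩ u hu
      (Q := fun x s η => f x s η = g x s η) hfg)
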